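/- Let $M$ be a smooth manifold of dimension $2k$. An almost paracomplex structure on $M$ is a smooth field $\varphi$ of endomorphisms of the tangent spaces with $\varphi^2=\mathrm{id}$ whose $+1$ and $-1$ eigenbundles have the same rank; a smooth Riemannian metric $g$ is anti-paraHermitian with respect to $\varphi$ if $g(\varphi X,\varphi Y)=g(X,Y)$ for all $X,Y$; and $(M,\varphi,g)$ is anti-paraKähler if moreover $\nabla\varphi=0$, where $\nabla$ is the Levi-Civita connection of $g$. Let $(M,\varphi,g)$ be an anti-paraKähler manifold and $\delta\in\mathbb R$. Let $g_{BS}$ be the Berger type deformed Sasaki metric on the tangent bundle $TM$, that is, the metric which at a point $u\in TM$ satisfies $$g_{BS}({}^HX,{}^HY)=g(X,Y),\qquad g_{BS}({}^VX,{}^HY)=g_{BS}({}^HX,{}^VY)=0,$$ $$g_{BS}({}^VX,{}^VY)=g(X,Y)+\delta^2 g(X,\varphi u)\,g(Y,\varphi u),$$ where ${}^HX$ and ${}^VX$ denote the horizontal lift (with respect to $\nabla$) and the vertical lift of a vector field $X$ on $M$. Let $h$ be another Riemannian metric on $M$ that is anti-paraHermitian with respect to an almost paracomplex structure $\varphi_1$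 on $M$. A smooth map $f:(M',g')\to(N,g'')$ of Riemannian manifolds is harmonic if its tension field vanishes, i.e. if in local coordinates, for all $\gamma$, $$g'^{ij}\Big(\frac{\partial^2 f^\gamma}{\partial x^i\partial x^j}-{}^{M'}\Gamma^k_{ij}\frac{\partial f^\gamma}{\partial x^k}+{}^{N}\Gamma^\gamma_{\alpha\beta}\frac{\partial f^\alpha}{\partial x^i}\frac{\partial f^\beta}{\partial x^j}\Big)=0.$$ Then the projection $\pi:(TM,g_{BS})\to(M,h)$ is a harmonic map if and only if $h$ is harmonic with respect to $g$, that is, if and only if in local coordinates $$g^{ij}\big({}^h\Gamma^k_{ij}-\Gamma^k_{ij}\big)=0\quad\text{for all } k,$$ where ${}^h\Gamma^k_{ij}$ and $\Gamma^k_{ij}$ are the Christoffel symbols of $h$ and $g$. -/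

import Mathlib

open Bundle Manifold ContDiff Module

noncomputable section

/-! ### Local formulas on an open subset of a finite-dimensional real vector space

Indices refer to the basis `Module.finBasis ℝ E`; contractions with the inverse metric do not
depend on this choice. -/

section Local

variable {E : Type*} [NormedAddCommGroup E] [NormedSpace ℝ E] [FiniteDimensional ℝ E]
  {F : Type*} [NormedAddCommGroup F] [NormedSpace ℝ F]

/-- The matrix `(B^{ij})`, inverse of the matrix `B_{ij} = B (b i) (b j)` of a bilinear form. -/
def inverseGram (B : E → E → ℝ) : Matrix (Fin (finrank ℝ E)) (Fin (finrank ℝ E)) ℝ :=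
  (Matrix.of fun i j => B (finBasis ℝ E i) (finBasis ℝ E j))⁻¹

/-- The contraction `B^{ij} T_{ij}` of a vector-valued bilinear map `T` with the inverse of `B`. -/
def metricTrace (B : E → E → ℝ) (T : E → E → F) : F :=
  ∑ i, ∑ j, inverseGram B i j • T (finBasis ℝ E i) (finBasis ℝ E j)

/-- The Christoffel symbols of the metric `G` (written in coordinates) at the point `y`, as the map
`(u, v) ↦ Γ^k_{ij} u^i v^j ∂_k`, where
`Γ^k_{ij} = (1/2) G^{kl} (∂_i G_{jl} + ∂_j G_{il} - ∂_l G_{ij})`. -/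
def christoffel (G : E → E → E → ℝ) (y : E) (u v : E) : E :=
  ∑ k, (∑ l, inverseGram (G y) k l * ((1 / 2 : ℝ) *
      (fderiv ℝ (fun z => G z v (finBasis ℝ E l)) y u
        + fderiv ℝ (fun z => G z u (finBasis ℝ E l)) y v
        - fderiv ℝ (fun z => G z u v) y (finBasis ℝ E l)))) • finBasis ℝ E k

end Local

/-! ### Tensors on a manifold without boundary

In Mathlib the tangent space `T_x M` is identified with the model space `E` through the preferred
chart `extChartAt I x` at `x`. Tensors at `x` (Christoffel symbols at `x`, covariant derivatives,
tension field) are therefore computed in the local coordinates given by this chart. -/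

section Manifold

variable {E : Type*} [NormedAddCommGroup E] [NormedSpace ℝ E]
  {H : Type*} [TopologicalSpace H] (I : ModelWithCorners ℝ E H)
  {M : Type*} [TopologicalSpace M] [ChartedSpace H M]

variable (M) in
/-- Fields of scalar products on the tangent spaces of `M` (the definitions below are used for
fields that are smooth Riemannian metrics). -/
abbrev MetricField : Type _ := ∀ x : M, TangentSpace I x → TangentSpace I x → ℝ

/-- The metric `g` in the local coordinates given by the chart at `x₀`: at a point `y` of the target
of the chart, `G_{ij} = g (∂_i, ∂_j)`, with `∂_i` the image of the `i`-th basis vector under the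
differential at `y` of the inverse of the chart. -/
def coordMetric (g : MetricField I M) (x₀ : M) : E → E → E → ℝ := fun y u v =>
  g ((extChartAt I x₀).symm y) (mfderiv 𝓘(ℝ, E) I (extChartAt I x₀).symm y u)
    (mfderiv 𝓘(ℝ, E) I (extChartAt I x₀).symm y v)

/-- An endomorphism field in the local coordinates given by the chart at `x₀`. -/
def coordEndo (φ : ∀ x : M, TangentSpace I x →L[ℝ] TangentSpace I x) (x₀ : M) : E → E → E :=
  fun y v => mfderiv I 𝓘(ℝ, E) (extChartAt I x₀) ((extChartAt I x₀).symm y)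
    (φ ((extChartAt I x₀).symm y) (mfderiv 𝓘(ℝ, E) I (extChartAt I x₀).symm y v))

variable [FiniteDimensional ℝ E]

/-- The Christoffel symbols of the Levi-Civita connection of `g` at the point `x`, in the local
coordinates given by the chart at `x`. -/
def christoffelAt (g : MetricField I M) (x : M) (u v : E) : E :=
  christoffel (coordMetric I g x) (extChartAt I x x) u v

/-- The covariant derivative `(∇_w φ) v = ∂_w φ (v) + Γ(w, φ v) - φ (Γ(w, v))` at `x` of an
endomorphism field `φ` with respect to the Levi-Civita connection of `g`. -/
def covDerivEndo (g : MetricField I M) (φ : ∀ x : M, TangentSpace I x →L[ℝ] TangentSpace I x)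
    (x : M) (w v : E) : E :=
  letI Φ : E → E → E := coordEndo I φ x
  letI y : E := extChartAt I x x
  letI Γ : E → E → E := christoffelAt I g x
  fderiv ℝ (fun z => Φ z v) y w + Γ w (Φ y v) - Φ y (Γ w v)

/-- `h` is harmonic with respect to `g`: `g^{ij} (ʰΓ^k_{ij} - Γ^k_{ij}) = 0`, where `ʰΓ` and `Γ` are
the Christoffel symbols of `h` and `g`. -/
def IsHarmonicMetric (g h : MetricField I M) : Prop :=
  ∀ x : M, metricTrace (coordMetric I g x (extChartAt I x x))
    (fun u v => christoffelAt I h x u v - christoffelAt I g x u v) = 0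

end Manifold

/-! ### Harmonic maps -/

section HarmonicMaps

variable {E : Type*} [NormedAddCommGroup E] [NormedSpace ℝ E] [FiniteDimensional ℝ E]
  {H : Type*} [TopologicalSpace H] (I : ModelWithCorners ℝ E H)
  {M : Type*} [TopologicalSpace M] [ChartedSpace H M]
  {E' : Type*} [NormedAddCommGroup E'] [NormedSpace ℝ E'] [FiniteDimensional ℝ E']
  {H' : Type*} [TopologicalSpace H'] (J : ModelWithCorners ℝ E' H')
  {N : Type*} [TopologicalSpace N] [ChartedSpace H' N]

/-- The second fundamental form
`β(f)(∂_i, ∂_j) = (∂_i ∂_j f^γ - ᴹΓ^k_{ij} ∂_k f^γ + ᴺΓ^γ_{αβ} ∂_i f^α ∂_j f^β) ∂_γ`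
of `f : (M, g) → (N, h)` at the point `x`, computed in the charts at `x` and at `f x`. -/
def secondFundamentalForm (g : MetricField I M) (h : MetricField J N) (f : M → N) (x : M)
    (u v : E) : E' :=
  letI y : E := extChartAt I x x
  letI F : E → E' := writtenInExtChartAt I J x f
  letI D : E →L[ℝ] E' := fderiv ℝ F y
  fderiv ℝ (fderiv ℝ F) y u v - D (christoffelAt I g x u v) + christoffelAt J h (f x) (D u) (D v)

/-- The tension field `τ(f) = g^{ij} β(f)(∂_i, ∂_j)`. -/
def tensionField (g : MetricField I M) (h : MetricField J N) (f : M → N) (x : M) :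
    E' :=
  metricTrace (coordMetric I g x (extChartAt I x x))
    (secondFundamentalForm I J g h f x)

/-- A harmonic map is a smooth map with vanishing tension field. -/
def IsHarmonicMap (g : MetricField I M) (h : MetricField J N) (f : M → N) : Prop :=
  ContMDiff I J ∞ f ∧ ∀ x : M, tensionField I J g h f x = 0

end HarmonicMaps

/-! ### Anti-paraKähler structures and the Berger type deformed Sasaki metric -/

section Berger

variable {E : Type*} [NormedAddCommGroup E] [NormedSpace ℝ E]
  {H : Type*} [TopologicalSpace H] {I : ModelWithCorners ℝ E H}
  {M : Type*} [TopologicalSpace M] [ChartedSpace H M] [IsManifold I ∞ M]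

/-- The scalar products of a smooth Riemannian metric. -/
def metricField (g : ContMDiffRiemannianMetric I ∞ E (fun x : M => TangentSpace I x)) :
    MetricField I M :=
  fun x u v => g.inner x u v

/-- An almost paracomplex structure: a smooth field `φ` of endomorphisms of the tangent spaces with
`φ² = id` whose eigenbundles for the eigenvalues `1` and `-1` have the same rank. -/
structure IsAlmostParacomplex (φ : ∀ x : M, TangentSpace I x →L[ℝ] TangentSpace I x) :
    Prop where
  smooth : ContMDiff I (I.prod 𝓘(ℝ, E →L[ℝ] E)) ∞
    (fun x : M => TotalSpace.mk' (E →L[ℝ] E)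
      (E := fun x : M => TangentSpace I x →L[ℝ] TangentSpace I x) x (φ x))
  sq_eq_id : ∀ (x : M) (v : TangentSpace I x), φ x (φ x v) = v
  rank_eq : ∀ x : M,
    finrank ℝ (End.eigenspace (φ x : TangentSpace I x →ₗ[ℝ] TangentSpace I x) 1) =
      finrank ℝ (End.eigenspace (φ x : TangentSpace I x →ₗ[ℝ] TangentSpace I x) (-1))

/-- `(M, φ, g)` is an almost anti-paraHermitian manifold. -/
structure IsAntiParaHermitian
    (g : ContMDiffRiemannianMetric I ∞ E (fun x : M => TangentSpace I x))
    (φ : ∀ x : M, TangentSpace I x →L[ℝ] TangentSpace I x) : Prop where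
  almostParacomplex : IsAlmostParacomplex φ
  compatible : ∀ (x : M) (u v : TangentSpace I x),
    g.inner x (φ x u) (φ x v) = g.inner x u v

variable [FiniteDimensional ℝ E]

/-- `(M, φ, g)` is an anti-paraKähler manifold: almost anti-paraHermitian, with `∇φ = 0` for the
Levi-Civita connection `∇` of `g`. -/
structure IsAntiParaKahler
    (g : ContMDiffRiemannianMetric I ∞ E (fun x : M => TangentSpace I x))
    (φ : ∀ x : M, TangentSpace I x →L[ℝ] TangentSpace I x) : Prop where
  antiParaHermitian : IsAntiParaHermitian g φ
  parallel : ∀ (x : M) (w v : E), covDerivEndo I (metricField g) φ x w v = 0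

/-- The differential `π_* : T_v (TM) → T_{π v} M` of the projection, `w = (dx, du) ↦ dx` in the
coordinates `(x, u)` on `TM` induced by the chart of `M` at `π v`. -/
def horizontalPart (v : TangentBundle I M) (w : TangentSpace I.tangent v) : TangentSpace I v.proj :=
  Prod.fst (α := E) (β := E) w

/-- The connection map `T_v (TM) → T_{π v} M` of the Levi-Civita connection of `g`,
`w = (dx, du) ↦ δu^i = du^i + Γ^i_{hj} u^j dx^h`, in the coordinates `(x, u)` on `TM` induced by the
chart of `M` at `π v`. Its kernel is spanned by the `E_i = ∂/∂x^i - Γ^h_{ij} u^j ∂/∂u^h`. -/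
def verticalPart (g : ContMDiffRiemannianMetric I ∞ E (fun x : M => TangentSpace I x))
    (v : TangentBundle I M) (w : TangentSpace I.tangent v) : TangentSpace I v.proj :=
  (Prod.snd (α := E) (β := E) w
    + christoffelAt I (metricField g) v.proj (horizontalPart v w) v.snd : E)

/-- The Berger type deformed Sasaki metric on `TM`: horizontal and vertical vectors are orthogonal,
`g_BS (ᴴX, ᴴY) = g (X, Y)` and `g_BS (ⱽX, ⱽY) = g (X, Y) + δ² g (X, φ u) g (Y, φ u)` at the point
`u` of `TM`. -/
def bergerSasaki (g : ContMDiffRiemannianMetric I ∞ E (fun x : M => TangentSpace I x))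
    (φ : ∀ x : M, TangentSpace I x →L[ℝ] TangentSpace I x) (δ : ℝ) :
    MetricField I.tangent (TangentBundle I M) := fun u w w' =>
  g.inner u.proj (horizontalPart u w) (horizontalPart u w')
    + (g.inner u.proj (verticalPart g u w) (verticalPart g u w')
      + δ ^ 2 * g.inner u.proj (verticalPart g u w) (φ u.proj u.snd)
        * g.inner u.proj (verticalPart g u w') (φ u.proj u.snd))

end Berger

end

noncomputable section

set_option maxSynthPendingDepth 3

section LinearAlgebra

variable {E : Type*} [NormedAddCommGroup E] [NormedSpace ℝ E] [FiniteDimensional ℝ E]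
  {F : Type*} [NormedAddCommGroup F] [NormedSpace ℝ F]

/-- A symmetric positive definite form has an orthonormal basis. -/
theorem exists_orthonormalBasis_form (B : E →L[ℝ] E →L[ℝ] ℝ) (hs : ∀ u v, B u v = B v u)
    (hp : ∀ v, v ≠ 0 → 0 < B v v) :
    ∃ e : Basis (Fin (finrank ℝ E)) ℝ E, ∀ i j, B (e i) (e j) = if i = j then 1 else 0 := by
  let B' : LinearMap.BilinForm ℝ E := LinearMap.mk₂ ℝ (fun u v => B u v)
    (by simp) (by simp) (by simp) (by simp)
  have hB' : ∀ u v, B' u v = B u v := fun u v => rfl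
  obtain ⟨v, hv⟩ := LinearMap.BilinForm.exists_orthogonal_basis (B := B')
    ⟨fun x y => by simpa [hB'] using hs x y⟩
  have hpos : ∀ i, 0 < B (v i) (v i) := fun i => hp _ (v.ne_zero i)
  have hw : ∀ i, IsUnit ((Real.sqrt (B (v i) (v i)))⁻¹) := fun i =>
    (inv_ne_zero (Real.sqrt_pos.2 (hpos i)).ne').isUnit
  refine ⟨v.isUnitSMul hw, fun i j => ?_⟩
  simp only [Basis.isUnitSMul_apply, map_smul, smul_apply, smul_eq_mul]
  split_ifs with hij
  · subst hij
    have h0 : Real.sqrt (B (v i) (v i)) ≠ 0 := (Real.sqrt_pos.2 (hpos i)).ne'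
    field_simp
    exact (Real.sq_sqrt (hpos i).le).symm
  · have : B (v i) (v j) = 0 := hv hij
    simp [this]

/-- The inverse Gram matrix in terms of an orthonormal basis. -/
theorem inverseGram_eq_sum {ι : Type*} [Fintype ι] [DecidableEq ι] (B : E →L[ℝ] E →L[ℝ] ℝ)
    (e : Basis ι ℝ E) (he : ∀ i j, B (e i) (e j) = if i = j then 1 else 0) (i j) :
    inverseGram (fun u v => B u v) i j =
      ∑ m, (finBasis ℝ E).repr (e m) i * (finBasis ℝ E).repr (e m) j := by
  set b := finBasis ℝ E
  have hB : (Matrix.of fun i j => B (b i) (b j)) = (e.toMatrix b).transpose * e.toMatrix b := by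
    ext i j
    simp only [Matrix.of_apply, Matrix.mul_apply, Matrix.transpose_apply, Basis.toMatrix_apply]
    conv_lhs => rw [← e.sum_repr (b i), ← e.sum_repr (b j)]
    simp only [map_sum, map_smul, sum_apply, smul_apply, he]
    simp [mul_comm]
  have hinv : inverseGram (fun u v => B u v) = b.toMatrix e * (b.toMatrix e).transpose := by
    refine Matrix.inv_eq_right_inv ?_
    rw [hB, Matrix.mul_assoc, ← Matrix.mul_assoc (e.toMatrix b), Basis.toMatrix_mul_toMatrix_flip,
      Matrix.one_mul, ← Matrix.transpose_mul, Basis.toMatrix_mul_toMatrix_flip,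
      Matrix.transpose_one]
  rw [hinv]
  simp [Matrix.mul_apply, Basis.toMatrix_apply]

/-- The metric contraction computed in an orthonormal basis. -/
theorem metricTrace_eq_sum {ι : Type*} [Fintype ι] [DecidableEq ι] (B : E →L[ℝ] E →L[ℝ] ℝ)
    (e : Basis ι ℝ E) (he : ∀ i j, B (e i) (e j) = if i = j then 1 else 0)
    (T : E →ₗ[ℝ] E →ₗ[ℝ] F) :
    metricTrace (fun u v => B u v) (fun u v => T u v) = ∑ m, T (e m) (e m) := by
  unfold metricTrace
  simp only [inverseGram_eq_sum B e he, Finset.sum_smul]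
  set b := finBasis ℝ E
  have h1 : ∀ m, T (e m) (e m) =
      ∑ i, ∑ j, (b.repr (e m) i * b.repr (e m) j) • T (b i) (b j) := by
    intro m
    conv_lhs => rw [← b.sum_repr (e m)]
    simp only [map_sum, LinearMap.sum_apply, map_smul, LinearMap.smul_apply, mul_smul,
      Finset.smul_sum]
    rw [Finset.sum_comm]
    refine Finset.sum_congr rfl fun i _ => Finset.sum_congr rfl fun j _ => ?_
    rw [smul_comm]
  simp only [h1]
  rw [Finset.sum_comm' (t' := Finset.univ) (s' := fun _ => Finset.univ) (by simp)]
  conv_rhs => rw [Finset.sum_comm]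
  rw [Finset.sum_comm]
  refine Finset.sum_congr rfl fun i _ => ?_
  rw [Finset.sum_comm]

/-- Raising the index of a linear form. -/
theorem apply_inverseGram_sum (B : E →L[ℝ] E →L[ℝ] ℝ) (hs : ∀ u v, B u v = B v u)
    (hp : ∀ v, v ≠ 0 → 0 < B v v) (l : E →ₗ[ℝ] ℝ) (c : E) :
    B (∑ k, (∑ m, inverseGram (fun u v => B u v) k m * l (finBasis ℝ E m)) • finBasis ℝ E k) c
      = l c := by
  obtain ⟨e, he⟩ := exists_orthonormalBasis_form B hs hp
  set b := finBasis ℝ E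
  have h1 : ∑ k, (∑ m, inverseGram (fun u v => B u v) k m * l (b m)) • b k
      = ∑ n, l (e n) • e n := by
    have h2 : ∀ n, l (e n) • e n =
        ∑ k, ∑ m, ((b.repr (e n) k * b.repr (e n) m) * l (b m)) • b k := by
      intro n
      have h3 : l (e n) = ∑ m, b.repr (e n) m * l (b m) := by
        conv_lhs => rw [← b.sum_repr (e n)]
        simp only [map_sum, map_smul, smul_eq_mul]
      rw [h3]
      conv_lhs => rhs; rw [← b.sum_repr (e n)]
      simp only [Finset.smul_sum, ← Finset.sum_smul, smul_smul, Finset.sum_mul]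
      refine Finset.sum_congr rfl fun i _ => congrArg (· • b i) ?_
      exact Finset.sum_congr rfl fun j _ => by ring
    simp only [h2, inverseGram_eq_sum B e he, Finset.sum_mul, Finset.sum_smul]
    rw [Finset.sum_comm (s := (Finset.univ : Finset (Fin (finrank ℝ E)))) (t := Finset.univ)
      (f := fun n k => ∑ m, ((b.repr (e n) k * b.repr (e n) m) * l (b m)) • b k)]
    refine Finset.sum_congr rfl fun i _ => ?_
    rw [Finset.sum_comm]
  rw [h1]
  conv_rhs => rw [← e.sum_repr c]
  conv_lhs => rw [← e.sum_repr c]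
  simp only [map_sum, map_smul, sum_apply, smul_apply, he]
  simp [mul_comm]

omit [FiniteDimensional ℝ E] in
theorem eq_of_forall_apply_eq (B : E →L[ℝ] E →L[ℝ] ℝ)
    (hp : ∀ v, v ≠ 0 → 0 < B v v) {u v : E} (h : ∀ c, B u c = B v c) : u = v := by
  by_contra hne
  have := hp (u - v) (sub_ne_zero.2 hne)
  have h0 : B (u - v) = 0 := by ext c; simp [h]
  simp [h0] at this

theorem isInvertible_of_posDef (B : E →L[ℝ] E →L[ℝ] ℝ)
    (hp : ∀ v, v ≠ 0 → 0 < B v v) : B.IsInvertible := by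
  have hinj : Function.Injective B := fun u v h =>
    eq_of_forall_apply_eq B hp fun c => by rw [h]
  have hdim : finrank ℝ E = finrank ℝ (E →L[ℝ] ℝ) := by
    rw [← (LinearMap.toContinuousLinearMap (𝕜 := ℝ) (E := E) (F' := ℝ)).finrank_eq]
    exact (Subspace.dual_finrank_eq).symm
  let e : E ≃ₗ[ℝ] (E →L[ℝ] ℝ) :=
    LinearEquiv.ofInjectiveOfFinrankEq (B : E →ₗ[ℝ] (E →L[ℝ] ℝ)) hinj hdim
  refine ⟨e.toContinuousLinearEquiv, ?_⟩
  ext u v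
  rfl

end LinearAlgebra

section Christoffel

variable {E : Type*} [NormedAddCommGroup E] [NormedSpace ℝ E]
  {X : Type*} [NormedAddCommGroup X] [NormedSpace ℝ X]
  {F : Type*} [NormedAddCommGroup F] [NormedSpace ℝ F]

theorem fderiv_bilinear {G : X → E →L[ℝ] E →L[ℝ] F} {A B : X → E} {y : X}
    (hG : DifferentiableAt ℝ G y) (hA : DifferentiableAt ℝ A y) (hB : DifferentiableAt ℝ B y)
    (c : X) : fderiv ℝ (fun z => G z (A z) (B z)) y c =
      fderiv ℝ G y c (A y) (B y) + G y (fderiv ℝ A y c) (B y) + G y (A y) (fderiv ℝ B y c) := by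
  rw [((hG.hasFDerivAt.clm_apply hA.hasFDerivAt).clm_apply hB.hasFDerivAt).fderiv]
  simp only [add_apply, ContinuousLinearMap.comp_apply, ContinuousLinearMap.flip_apply]
  abel

theorem fderiv_apply_apply {G : X → E →L[ℝ] E →L[ℝ] F} {y : X}
    (hG : DifferentiableAt ℝ G y) (u v : E) (c : X) :
    fderiv ℝ (fun z => G z u v) y c = fderiv ℝ G y c u v := by
  rw [fderiv_bilinear hG (differentiableAt_const u) (differentiableAt_const v)]
  simp

theorem differentiableAt_comp_and_fderiv {Y : Type*} [NormedAddCommGroup Y] [NormedSpace ℝ Y]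
    {G : Y → F} {τ : X → Y} {y : X} (hG : DifferentiableAt ℝ G (τ y))
    (hτ : DifferentiableAt ℝ τ y) : DifferentiableAt ℝ (fun z => G (τ z)) y ∧
      ∀ c, fderiv ℝ (fun z => G (τ z)) y c = fderiv ℝ G (τ y) (fderiv ℝ τ y c) :=
  ⟨hG.comp y hτ, fun c => by
    rw [show (fun z => G (τ z)) = G ∘ τ from rfl, fderiv_comp y hG hτ]; rfl⟩

/-- The chain rule for `z ↦ G (τ z) (A z) (B z)`. -/
theorem fderiv_bilinear_comp {Y : Type*} [NormedAddCommGroup Y] [NormedSpace ℝ Y]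
    {G : Y → E →L[ℝ] E →L[ℝ] F} {τ : X → Y} {A B : X → E} {y : X}
    (hG : DifferentiableAt ℝ G (τ y)) (hτ : DifferentiableAt ℝ τ y)
    (hA : DifferentiableAt ℝ A y) (hB : DifferentiableAt ℝ B y)
    (c : X) : fderiv ℝ (fun z => G (τ z) (A z) (B z)) y c =
      fderiv ℝ G (τ y) (fderiv ℝ τ y c) (A y) (B y) + G (τ y) (fderiv ℝ A y c) (B y)
        + G (τ y) (A y) (fderiv ℝ B y c) := by
  have h := differentiableAt_comp_and_fderiv hG hτ
  rw [fderiv_bilinear h.1 hA hB, h.2]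

theorem trilinear_add (D : X →L[ℝ] E →L[ℝ] E →L[ℝ] F) (c d : X) (u v u' v' : E) :
    D (c + d) u v = D c u v + D d u v ∧ D c (u + u') v = D c u v + D c u' v ∧
      D c u (v + v') = D c u v + D c u v' :=
  ⟨congrArg (fun L : E →L[ℝ] E →L[ℝ] F => L u v) (ContinuousLinearMap.map_add D c d),
    congrArg (fun L : E →L[ℝ] F => L v) (ContinuousLinearMap.map_add (D c) u u'),
    ContinuousLinearMap.map_add (D c u) v v'⟩

theorem trilinear_smul (D : X →L[ℝ] E →L[ℝ] E →L[ℝ] F) (a : ℝ) (c : X) (u v : E) :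
    D (a • c) u v = a • D c u v ∧ D c (a • u) v = a • D c u v ∧ D c u (a • v) = a • D c u v :=
  ⟨congrArg (fun L : E →L[ℝ] E →L[ℝ] F => L u v) (ContinuousLinearMap.map_smul D a c),
    congrArg (fun L : E →L[ℝ] F => L v) (ContinuousLinearMap.map_smul (D c) a u),
    ContinuousLinearMap.map_smul (D c u) a v⟩

variable [FiniteDimensional ℝ E]

/-- The Christoffel symbols of the first kind. -/
def christoffelForm (G : E → E →L[ℝ] E →L[ℝ] ℝ) (y u v : E) : E →L[ℝ] ℝ :=
  LinearMap.toContinuousLinearMap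
    { toFun := fun c => (1 / 2 : ℝ) *
        (fderiv ℝ G y u v c + fderiv ℝ G y v u c - fderiv ℝ G y c u v)
      map_add' := fun c d => by
        rw [(trilinear_add (fderiv ℝ G y) u 0 v c 0 d).2.2,
          (trilinear_add (fderiv ℝ G y) v 0 u c 0 d).2.2,
          (trilinear_add (fderiv ℝ G y) c d u v 0 0).1]
        ring
      map_smul' := fun a c => by
        rw [(trilinear_smul (fderiv ℝ G y) a u v c).2.2,
          (trilinear_smul (fderiv ℝ G y) a v u c).2.2, (trilinear_smul (fderiv ℝ G y) a c u v).1]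
        simp only [smul_eq_mul, RingHom.id_apply]; ring }

theorem christoffelForm_apply (G : E → E →L[ℝ] E →L[ℝ] ℝ) (y u v c : E) :
    christoffelForm G y u v c = (1 / 2 : ℝ) *
      (fderiv ℝ G y u v c + fderiv ℝ G y v u c - fderiv ℝ G y c u v) := rfl

/-- The Christoffel symbols as a continuous bilinear map. -/
def christoffelL (G : E → E →L[ℝ] E →L[ℝ] ℝ) (y : E) : E →L[ℝ] E →L[ℝ] E :=
  LinearMap.toContinuousLinearMap
    ((LinearMap.toContinuousLinearMap : (E →ₗ[ℝ] E) ≃ₗ[ℝ] (E →L[ℝ] E)).toLinearMap ∘ₗ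
      LinearMap.mk₂ ℝ (fun u v => (G y).inverse (christoffelForm G y u v))
        (fun u u' v => by
          rw [← map_add]; congr 1; ext c
          rw [add_apply]; simp only [christoffelForm_apply]
          rw [(trilinear_add (fderiv ℝ G y) u u' v c 0 0).1,
            (trilinear_add (fderiv ℝ G y) v 0 u c u' 0).2.1,
            (trilinear_add (fderiv ℝ G y) c 0 u v u' 0).2.1]
          ring)
        (fun a u v => by
          rw [← map_smul]; congr 1; ext c
          rw [smul_apply]; simp only [christoffelForm_apply]
          rw [(trilinear_smul (fderiv ℝ G y) a u v c).1,
            (trilinear_smul (fderiv ℝ G y) a v u c).2.1,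
            (trilinear_smul (fderiv ℝ G y) a c u v).2.1]
          simp only [smul_eq_mul]; ring)
        (fun u v v' => by
          rw [← map_add]; congr 1; ext c
          rw [add_apply]; simp only [christoffelForm_apply]
          rw [(trilinear_add (fderiv ℝ G y) v v' u c 0 0).1,
            (trilinear_add (fderiv ℝ G y) u 0 v c v' 0).2.1,
            (trilinear_add (fderiv ℝ G y) c 0 u v 0 v').2.2]
          ring)
        (fun a u v => by
          rw [← map_smul]; congr 1; ext c
          rw [smul_apply]; simp only [christoffelForm_apply]
          rw [(trilinear_smul (fderiv ℝ G y) a v u c).1,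
            (trilinear_smul (fderiv ℝ G y) a u v c).2.1,
            (trilinear_smul (fderiv ℝ G y) a c u v).2.2]
          simp only [smul_eq_mul]; ring))

theorem christoffelL_apply (G : E → E →L[ℝ] E →L[ℝ] ℝ) (y u v : E) :
    christoffelL G y u v = (G y).inverse (christoffelForm G y u v) := rfl

theorem apply_christoffelL {G : E → E →L[ℝ] E →L[ℝ] ℝ} {y : E}
    (hp : ∀ v, v ≠ 0 → 0 < G y v v) (u v c : E) :
    G y (christoffelL G y u v) c = (1 / 2 : ℝ) *
      (fderiv ℝ G y u v c + fderiv ℝ G y v u c - fderiv ℝ G y c u v) := by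
  rw [← christoffelForm_apply, christoffelL_apply]
  obtain ⟨e, he⟩ := isInvertible_of_posDef (G y) hp
  rw [← he, ContinuousLinearMap.inverse_equiv]
  simp

theorem christoffel_eq_christoffelL {G : E → E →L[ℝ] E →L[ℝ] ℝ} {y : E}
    (hG : DifferentiableAt ℝ G y)
    (hs : ∀ u v, G y u v = G y v u) (hp : ∀ v, v ≠ 0 → 0 < G y v v) (u v : E) :
    christoffel (fun z u v => G z u v) y u v = christoffelL G y u v := by
  refine eq_of_forall_apply_eq (G y) hp fun c => ?_
  rw [apply_christoffelL hp, ← christoffelForm_apply]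
  simp only [christoffel, fderiv_apply_apply hG]
  rw [← ContinuousLinearMap.coe_coe (christoffelForm G y u v),
    ← apply_inverseGram_sum (G y) hs hp (christoffelForm G y u v : E →ₗ[ℝ] ℝ) c]
  simp only [ContinuousLinearMap.coe_coe, christoffelForm_apply]

theorem christoffel_congr {G G' : E → E → E → ℝ} {y : E} (h : G =ᶠ[nhds y] G') :
    christoffel G y = christoffel G' y := by
  have h1 : ∀ u v, fderiv ℝ (fun z => G z u v) y = fderiv ℝ (fun z => G' z u v) y := fun u v =>
    Filter.EventuallyEq.fderiv_eq (h.mono fun z hz => by simp [hz])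
  funext u v
  simp only [christoffel, h1, h.eq_of_nhds]

omit [FiniteDimensional ℝ E] in
theorem fderiv_form_symm {G : E → E →L[ℝ] E →L[ℝ] ℝ} {y : E} (hG : DifferentiableAt ℝ G y)
    (hs : ∀ᶠ z in nhds y, ∀ u v, G z u v = G z v u) (u v c : E) :
    fderiv ℝ G y c u v = fderiv ℝ G y c v u := by
  rw [← fderiv_apply_apply hG, ← fderiv_apply_apply hG]
  rw [Filter.EventuallyEq.fderiv_eq (hs.mono fun z hz => hz u v)]

/-- The Levi-Civita connection is metric. -/
theorem fderiv_eq_christoffelL {G : E → E →L[ℝ] E →L[ℝ] ℝ} {y : E}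
    (hG : DifferentiableAt ℝ G y)
    (hs : ∀ᶠ z in nhds y, ∀ u v, G z u v = G z v u) (hp : ∀ v, v ≠ 0 → 0 < G y v v) (c u v : E) :
    fderiv ℝ G y c u v = G y (christoffelL G y c u) v + G y u (christoffelL G y c v) := by
  have h1 := fderiv_form_symm hG hs
  rw [hs.self_of_nhds u, apply_christoffelL hp, apply_christoffelL hp, h1 v u, h1 c u, h1 c v]
  ring

theorem contDiffOn_christoffelL {G : E → E →L[ℝ] E →L[ℝ] ℝ} {s : Set E} (ho : IsOpen s)
    (hG : ContDiffOn ℝ ∞ G s) (hp : ∀ y ∈ s, ∀ v, v ≠ 0 → 0 < G y v v) :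
    ContDiffOn ℝ ∞ (christoffelL G) s := by
  have hd : ∀ y ∈ s, DifferentiableAt ℝ G y := fun y hy =>
    (hG.contDiffAt (ho.mem_nhds hy)).differentiableAt (by simp)
  have h1 : ∀ c u v, ContDiffOn ℝ ∞ (fun y => fderiv ℝ G y c u v) s := by
    intro c u v
    have h2 : ContDiffOn ℝ ∞ (fun y => G y u v) s :=
      (hG.clm_apply contDiffOn_const).clm_apply contDiffOn_const
    have h3 : ContDiffOn ℝ ∞ (fderiv ℝ fun y => G y u v) s := h2.fderiv_of_isOpen ho (by simp)
    exact (h3.clm_apply contDiffOn_const).congr fun y hy =>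
      (fderiv_apply_apply (hd y hy) u v c).symm
  have h4 : ContDiffOn ℝ ∞ (fun z => (G z).inverse) s := fun y hy =>
    ((isInvertible_of_posDef (G y) (hp y hy)).contDiffAt_map_inverse.comp y
      (hG.contDiffAt (ho.mem_nhds hy))).contDiffWithinAt
  refine contDiffOn_clm_apply.2 fun u => contDiffOn_clm_apply.2 fun v => ?_
  simp only [christoffelL_apply]
  refine h4.clm_apply (contDiffOn_clm_apply.2 fun c => ?_)
  simp only [christoffelForm_apply]
  exact contDiffOn_const.mul (((h1 _ _ _).add (h1 _ _ _)).sub (h1 _ _ _))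

/-- The transformation law of the Christoffel symbols under a change of coordinates `τ`. -/
theorem christoffelL_transform {G G' : E → E →L[ℝ] E →L[ℝ] ℝ} {τ : E → E} {y : E}
    (hG : DifferentiableAt ℝ G y)
    (hG' : DifferentiableAt ℝ G' (τ y)) (hτ : ContDiffAt ℝ ∞ τ y)
    (hp : ∀ v, v ≠ 0 → 0 < G y v v) (hp' : ∀ v, v ≠ 0 → 0 < G' (τ y) v v)
    (hs' : ∀ u v, G' (τ y) u v = G' (τ y) v u)
    (hsurj : Function.Surjective (fderiv ℝ τ y))
    (h : ∀ᶠ z in nhds y, ∀ u v, G z u v = G' (τ z) (fderiv ℝ τ z u) (fderiv ℝ τ z v)) (u v : E) :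
    fderiv ℝ τ y (christoffelL G y u v) =
      fderiv ℝ (fderiv ℝ τ) y u v + christoffelL G' (τ y) (fderiv ℝ τ y u) (fderiv ℝ τ y v) := by
  have hτd : DifferentiableAt ℝ τ y := hτ.differentiableAt (by simp)
  have hτ' : DifferentiableAt ℝ (fderiv ℝ τ) y :=
    (hτ.fderiv_right (m := 1) (by norm_cast)).differentiableAt (by simp)
  have hsymm : ∀ u v, fderiv ℝ (fderiv ℝ τ) y u v = fderiv ℝ (fderiv ℝ τ) y v u :=
    fun u v => hτ.isSymmSndFDerivAt (by simp; norm_cast) u v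
  have hτu : ∀ u, DifferentiableAt ℝ (fun z => fderiv ℝ τ z u) y := fun u =>
    hτ'.clm_apply (differentiableAt_const u)
  have hτu' : ∀ u c, fderiv ℝ (fun z => fderiv ℝ τ z u) y c = fderiv ℝ (fderiv ℝ τ) y c u :=
    fun u c => by
      rw [(hτ'.hasFDerivAt.clm_apply (hasFDerivAt_const u y)).fderiv]; simp
  have hdG : ∀ u v c, fderiv ℝ G y c u v =
      fderiv ℝ G' (τ y) (fderiv ℝ τ y c) (fderiv ℝ τ y u) (fderiv ℝ τ y v)
      + G' (τ y) (fderiv ℝ (fderiv ℝ τ) y c u) (fderiv ℝ τ y v)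
      + G' (τ y) (fderiv ℝ τ y u) (fderiv ℝ (fderiv ℝ τ) y c v) := by
    intro u v c
    rw [← fderiv_apply_apply hG, Filter.EventuallyEq.fderiv_eq (h.mono fun z hz => hz u v),
      fderiv_bilinear_comp hG' hτd (hτu u) (hτu v), hτu', hτu']
  refine eq_of_forall_apply_eq (G' (τ y)) hp' fun c' => ?_
  obtain ⟨c, rfl⟩ := hsurj c'
  rw [← h.self_of_nhds, apply_christoffelL hp, ContinuousLinearMap.map_add (G' (τ y)), add_apply,
    apply_christoffelL hp', hdG, hdG, hdG, hsymm v u, hsymm c u, hsymm c v,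
    hs' (fderiv ℝ τ y v) (fderiv ℝ (fderiv ℝ τ) y u c),
    hs' (fderiv ℝ τ y u) (fderiv ℝ (fderiv ℝ τ) y v c)]
  ring

end Christoffel

section BergerForm

variable {E : Type*} [NormedAddCommGroup E] [NormedSpace ℝ E]

/-- The connection map in coordinates: `(a, b) ↦ b + Γ (a, w)` at the point `(y, w)`. -/
def connectionMap (Γ : E → E →L[ℝ] E →L[ℝ] E) (z : E × E) : E × E →L[ℝ] E :=
  ContinuousLinearMap.snd ℝ E E + ((Γ z.1).flip z.2) ∘L ContinuousLinearMap.fst ℝ E E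

theorem connectionMap_apply (Γ : E → E →L[ℝ] E →L[ℝ] E) (z A : E × E) :
    connectionMap Γ z A = A.2 + Γ z.1 A.1 z.2 := by simp [connectionMap]

/-- The Berger type deformed Sasaki metric in coordinates. -/
def bergerForm (G : E → E →L[ℝ] E →L[ℝ] ℝ) (Γ : E → E →L[ℝ] E →L[ℝ] E) (Φ : E → E →L[ℝ] E)
    (δ : ℝ) (z : E × E) : E × E →L[ℝ] E × E →L[ℝ] ℝ :=
  (G z.1).bilinearComp (ContinuousLinearMap.fst ℝ E E) (ContinuousLinearMap.fst ℝ E E)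
    + (G z.1 + δ ^ 2 • ContinuousLinearMap.smulRightL ℝ E (E →L[ℝ] ℝ)
      ((G z.1).flip (Φ z.1 z.2)) ((G z.1).flip (Φ z.1 z.2))).bilinearComp
        (connectionMap Γ z) (connectionMap Γ z)

theorem bergerForm_apply (G : E → E →L[ℝ] E →L[ℝ] ℝ) (Γ : E → E →L[ℝ] E →L[ℝ] E)
    (Φ : E → E →L[ℝ] E) (δ : ℝ) (z A B : E × E) :
    bergerForm G Γ Φ δ z A B = G z.1 A.1 B.1
      + (G z.1 (connectionMap Γ z A) (connectionMap Γ z B)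
        + δ ^ 2 * (G z.1 (connectionMap Γ z A) (Φ z.1 z.2))
          * G z.1 (connectionMap Γ z B) (Φ z.1 z.2)) := by
  simp [bergerForm, mul_assoc]

variable {G : E → E →L[ℝ] E →L[ℝ] ℝ} {Γ : E → E →L[ℝ] E →L[ℝ] E}
    {Φ : E → E →L[ℝ] E} {δ : ℝ} {z : E × E}

theorem differentiableAt_flip {X F E' : Type*} [NormedAddCommGroup X] [NormedSpace ℝ X]
    [NormedAddCommGroup F] [NormedSpace ℝ F] [NormedAddCommGroup E'] [NormedSpace ℝ E']
    {B : X → E →L[ℝ] E' →L[ℝ] F} {x : X}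
    (hB : DifferentiableAt ℝ B x) : DifferentiableAt ℝ (fun x => (B x).flip) x :=
  (ContinuousLinearMap.flipₗᵢ ℝ E E' F).toContinuousLinearEquiv.differentiableAt.comp x hB

theorem differentiableAt_bilinearComp {X E' : Type*} [NormedAddCommGroup X] [NormedSpace ℝ X]
    [NormedAddCommGroup E'] [NormedSpace ℝ E'] {B : X → E →L[ℝ] E →L[ℝ] ℝ}
    {K : X → E' →L[ℝ] E} {x : X}
    (hB : DifferentiableAt ℝ B x) (hK : DifferentiableAt ℝ K x) :
    DifferentiableAt ℝ (fun x => (B x).bilinearComp (K x) (K x)) x := by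
  unfold ContinuousLinearMap.bilinearComp
  exact differentiableAt_flip ((differentiableAt_flip (hB.clm_comp hK)).clm_comp hK)

theorem differentiableAt_connectionMap (hΓ : DifferentiableAt ℝ Γ z.1) :
    DifferentiableAt ℝ (connectionMap Γ) z := by
  unfold connectionMap
  have h1 : DifferentiableAt ℝ (fun z : E × E => Γ z.1) z := hΓ.comp z differentiableAt_fst
  exact (differentiableAt_const _).add
    (((differentiableAt_flip h1).clm_apply differentiableAt_snd).clm_comp
      (differentiableAt_const _))

theorem differentiableAt_bergerForm (hG : DifferentiableAt ℝ G z.1)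
    (hΓ : DifferentiableAt ℝ Γ z.1) (hΦ : DifferentiableAt ℝ Φ z.1) :
    DifferentiableAt ℝ (bergerForm G Γ Φ δ) z := by
  unfold bergerForm
  have h1 : DifferentiableAt ℝ (fun z : E × E => G z.1) z := hG.comp z differentiableAt_fst
  have h2 : DifferentiableAt ℝ (fun z : E × E => Φ z.1 z.2) z :=
    (DifferentiableAt.comp (g := Φ) z hΦ differentiableAt_fst).clm_apply differentiableAt_snd
  have h3 := (differentiableAt_flip h1).clm_apply h2
  have hV : DifferentiableAt ℝ (fun z : E × E => ContinuousLinearMap.smulRightL ℝ E (E →L[ℝ] ℝ)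
      ((G z.1).flip (Φ z.1 z.2)) ((G z.1).flip (Φ z.1 z.2))) z :=
    (((ContinuousLinearMap.smulRightL ℝ E (E →L[ℝ] ℝ)).differentiableAt).comp z h3).clm_apply h3
  exact (differentiableAt_bilinearComp h1 (differentiableAt_const _)).add
    (differentiableAt_bilinearComp (h1.add (hV.const_smul (δ ^ 2)))
      (differentiableAt_connectionMap hΓ))

theorem fderiv_connectionMap (hΓ : DifferentiableAt ℝ Γ z.1) (A C : E × E) :
    fderiv ℝ (fun z => connectionMap Γ z A) z C =
      fderiv ℝ Γ z.1 C.1 A.1 z.2 + Γ z.1 A.1 C.2 := by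
  simp only [connectionMap_apply]
  rw [fderiv_const_add, fderiv_bilinear_comp (τ := Prod.fst) (A := fun _ => A.1) (B := Prod.snd) hΓ
    differentiableAt_fst (differentiableAt_const _) differentiableAt_snd]
  simp [fderiv_fst, fderiv_snd]

theorem fderiv_add_add_const_mul_mul {X : Type*} [NormedAddCommGroup X] [NormedSpace ℝ X]
    {a b f g : X → ℝ} {x : X} (ha : DifferentiableAt ℝ a x) (hb : DifferentiableAt ℝ b x)
    (hf : DifferentiableAt ℝ f x) (hg : DifferentiableAt ℝ g x) (k : ℝ) (c : X) :
    fderiv ℝ (fun z => a z + (b z + k * (f z * g z))) x c =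
      fderiv ℝ a x c + (fderiv ℝ b x c + k * (fderiv ℝ f x c * g x + f x * fderiv ℝ g x c)) := by
  have h : HasFDerivAt (fun z => a z + (b z + k * (f z * g z))) _ x := ha.hasFDerivAt.add
    (hb.hasFDerivAt.add ((hf.hasFDerivAt.mul hg.hasFDerivAt).const_mul k))
  rw [h.fderiv]
  simp only [add_apply, smul_apply, smul_eq_mul]
  ring

theorem fderiv_bergerForm (hG : DifferentiableAt ℝ G z.1)
    (hΓ : DifferentiableAt ℝ Γ z.1) (hΦ : DifferentiableAt ℝ Φ z.1) (A B C : E × E) :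
    letI K := connectionMap Γ z
    letI dK := fun A => fderiv ℝ Γ z.1 C.1 A.1 z.2 + Γ z.1 A.1 C.2
    letI ξ := fun A => G z.1 (K A) (Φ z.1 z.2)
    letI dξ := fun A => fderiv ℝ G z.1 C.1 (K A) (Φ z.1 z.2) + G z.1 (dK A) (Φ z.1 z.2)
      + G z.1 (K A) (fderiv ℝ Φ z.1 C.1 z.2 + Φ z.1 C.2)
    fderiv ℝ (bergerForm G Γ Φ δ) z C A B =
      fderiv ℝ G z.1 C.1 A.1 B.1 + (fderiv ℝ G z.1 C.1 (K A) (K B) + G z.1 (dK A) (K B)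
        + G z.1 (K A) (dK B) + δ ^ 2 * (dξ A * ξ B + ξ A * dξ B)) := by
  have hK : ∀ A, DifferentiableAt ℝ (fun z => connectionMap Γ z A) z := fun A =>
    (differentiableAt_connectionMap hΓ).clm_apply (differentiableAt_const A)
  have hG1 : DifferentiableAt ℝ (fun z : E × E => G z.1) z := hG.comp z differentiableAt_fst
  have hΦ1 : DifferentiableAt ℝ (fun z : E × E => Φ z.1) z := hΦ.comp z differentiableAt_fst
  have hΦ2 : DifferentiableAt ℝ (fun z : E × E => Φ z.1 z.2) z := hΦ1.clm_apply differentiableAt_snd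
  have hΦd : fderiv ℝ (fun z : E × E => Φ z.1 z.2) z C =
      fderiv ℝ Φ z.1 C.1 z.2 + Φ z.1 C.2 := by
    rw [(hΦ1.hasFDerivAt.clm_apply (hasFDerivAt_snd (𝕜 := ℝ) (p := z))).fderiv]
    simp only [add_apply, ContinuousLinearMap.comp_apply, ContinuousLinearMap.flip_apply]
    rw [(differentiableAt_comp_and_fderiv hΦ (differentiableAt_fst (𝕜 := ℝ) (p := z))).2]
    simp [fderiv_fst, add_comm]
  have hξ : ∀ A, DifferentiableAt ℝ (fun z => G z.1 (connectionMap Γ z A) (Φ z.1 z.2)) z :=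
    fun A => (hG1.clm_apply (hK A)).clm_apply hΦ2
  have h1 : DifferentiableAt ℝ (fun z : E × E => G z.1 A.1 B.1) z :=
    (hG1.clm_apply (differentiableAt_const _)).clm_apply (differentiableAt_const _)
  have h2 : DifferentiableAt ℝ
      (fun z => G z.1 (connectionMap Γ z A) (connectionMap Γ z B)) z :=
    (hG1.clm_apply (hK A)).clm_apply (hK B)
  have hfst := differentiableAt_fst (𝕜 := ℝ) (p := z)
  rw [← fderiv_apply_apply (differentiableAt_bergerForm hG hΓ hΦ)]
  simp only [bergerForm_apply, mul_assoc]
  rw [fderiv_add_add_const_mul_mul h1 h2 (hξ A) (hξ B),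
    fderiv_bilinear_comp hG hfst (differentiableAt_const A.1)
    (differentiableAt_const B.1), fderiv_bilinear_comp hG hfst (hK A) (hK B),
    fderiv_bilinear_comp hG hfst (hK A) hΦ2, fderiv_bilinear_comp hG hfst (hK B) hΦ2,
    hΦd, fderiv_connectionMap hΓ, fderiv_connectionMap hΓ]
  simp [fderiv_fst]

theorem bergerForm_symm (hs : ∀ u v, G z.1 u v = G z.1 v u) (A B : E × E) :
    bergerForm G Γ Φ δ z A B = bergerForm G Γ Φ δ z B A := by
  rw [bergerForm_apply, bergerForm_apply, hs A.1, hs (connectionMap Γ z A) (connectionMap Γ z B)]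
  ring

theorem bergerForm_pos (hp : ∀ v, v ≠ 0 → 0 < G z.1 v v) (A : E × E) (hA : A ≠ 0) :
    0 < bergerForm G Γ Φ δ z A A := by
  have hp' : ∀ v, 0 ≤ G z.1 v v := fun v => by
    by_cases hv : v = 0
    · simp [hv]
    · exact (hp v hv).le
  rw [bergerForm_apply]
  have h2 : 0 ≤ δ ^ 2 * (G z.1 (connectionMap Γ z A) (Φ z.1 z.2))
      * G z.1 (connectionMap Γ z A) (Φ z.1 z.2) := by
    rw [mul_assoc]; exact mul_nonneg (sq_nonneg _) (mul_self_nonneg _)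
  by_cases h : A.1 = 0
  · have h3 : connectionMap Γ z A ≠ 0 := by
      rw [connectionMap_apply, h]
      simp only [map_zero, zero_apply, add_zero]
      exact fun h4 => hA (Prod.ext h h4)
    have := hp _ h3
    have := hp' A.1
    linarith
  · have := hp _ h
    have := hp' (connectionMap Γ z A)
    linarith

variable [FiniteDimensional ℝ E]

/-- The horizontal lift of `c` at `(y, w)`. -/
def horizontalLift (Γ : E → E →L[ℝ] E →L[ℝ] E) (z : E × E) (c : E) : E × E := (c, -Γ z.1 c z.2)

omit [FiniteDimensional ℝ E] in
theorem bergerForm_horizontalLift (A : E × E) (c : E) :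
    bergerForm G Γ Φ δ z A (horizontalLift Γ z c) = G z.1 A.1 c := by
  simp [bergerForm_apply, connectionMap_apply, horizontalLift]

theorem fst_christoffelL_vertical (hG : DifferentiableAt ℝ G z.1)
    (hs : ∀ᶠ y in nhds z.1, ∀ u v, G y u v = G y v u) (hp : ∀ v, v ≠ 0 → 0 < G z.1 v v)
    (hΓ : DifferentiableAt ℝ (christoffelL G) z.1) (hΦ : DifferentiableAt ℝ Φ z.1)
    (hpar : ∀ c v, fderiv ℝ Φ z.1 c v + christoffelL G z.1 c (Φ z.1 v)
      - Φ z.1 (christoffelL G z.1 c v) = 0) (p q : E) :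
    (christoffelL (bergerForm G (christoffelL G) Φ δ) z (0, p) (0, q)).1 = 0 := by
  refine eq_of_forall_apply_eq (G z.1) hp fun c => ?_
  rw [← bergerForm_horizontalLift (Γ := christoffelL G) (Φ := Φ) (δ := δ),
    apply_christoffelL (bergerForm_pos hp)]
  simp only [fderiv_bergerForm hG hΓ hΦ, connectionMap_apply, horizontalLift]
  have h1 : ∀ v, fderiv ℝ Φ z.1 c v - Φ z.1 (christoffelL G z.1 c v) =
      - christoffelL G z.1 c (Φ z.1 v) := fun v => by
    have := hpar c v
    rw [← sub_eq_zero, ← this]; abel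
  have h2 := fderiv_eq_christoffelL hG hs hp
  have hs0 := hs.self_of_nhds
  simp only [map_zero, zero_apply, add_zero, zero_add, map_neg,
    ← sub_eq_add_neg, neg_add_cancel, sub_self, h1, h2 c]
  rw [hs0 p, hs0 (christoffelL G z.1 c p) q]
  ring

theorem fst_christoffelL_horizontal (hG : DifferentiableAt ℝ G z.1)
    (hp : ∀ v, v ≠ 0 → 0 < G z.1 v v)
    (hΓ : DifferentiableAt ℝ (christoffelL G) z.1) (hΦ : DifferentiableAt ℝ Φ z.1) (a b : E) :
    (christoffelL (bergerForm G (christoffelL G) Φ δ) z (horizontalLift (christoffelL G) z a)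
      (horizontalLift (christoffelL G) z b)).1 = christoffelL G z.1 a b := by
  refine eq_of_forall_apply_eq (G z.1) hp fun c => ?_
  rw [← bergerForm_horizontalLift (Γ := christoffelL G) (Φ := Φ) (δ := δ),
    apply_christoffelL (bergerForm_pos hp), apply_christoffelL hp]
  simp only [fderiv_bergerForm hG hΓ hΦ, connectionMap_apply, horizontalLift]
  simp

/-- The trace of the second fundamental form of the projection, in coordinates. -/
theorem metricTrace_bergerForm (hG : DifferentiableAt ℝ G z.1)
    (hs : ∀ᶠ y in nhds z.1, ∀ u v, G y u v = G y v u) (hp : ∀ v, v ≠ 0 → 0 < G z.1 v v)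
    (hΓ : DifferentiableAt ℝ (christoffelL G) z.1) (hΦ : DifferentiableAt ℝ Φ z.1)
    (hpar : ∀ c v, fderiv ℝ Φ z.1 c v + christoffelL G z.1 c (Φ z.1 v)
      - Φ z.1 (christoffelL G z.1 c v) = 0) (S : E →L[ℝ] E →L[ℝ] E) :
    metricTrace (fun A B => bergerForm G (christoffelL G) Φ δ z A B)
      (fun A B => S A.1 B.1 - (christoffelL (bergerForm G (christoffelL G) Φ δ) z A B).1) =
    metricTrace (fun u v => G z.1 u v) (fun u v => S u v - christoffelL G z.1 u v) := by
  classical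
  set Γ := christoffelL G with hΓdef
  have hs0 := hs.self_of_nhds
  set V : E →L[ℝ] E →L[ℝ] ℝ := G z.1 + δ ^ 2 • ContinuousLinearMap.smulRightL ℝ E (E →L[ℝ] ℝ)
    ((G z.1).flip (Φ z.1 z.2)) ((G z.1).flip (Φ z.1 z.2)) with hV
  have hVa : ∀ p q, V p q = G z.1 p q + δ ^ 2 * (G z.1 p (Φ z.1 z.2) * G z.1 q (Φ z.1 z.2)) :=
    fun p q => by simp [hV]
  obtain ⟨e, he⟩ := exists_orthonormalBasis_form (G z.1) hs0 hp
  obtain ⟨f, hf⟩ := exists_orthonormalBasis_form V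
    (fun p q => by rw [hVa, hVa, hs0 p q]; ring)
    (fun v hv => by
      rw [hVa]
      exact add_pos_of_pos_of_nonneg (hp v hv) (mul_nonneg (sq_nonneg _) (mul_self_nonneg _)))
  let σ : (E × E) ≃ₗ[ℝ] E × E := LinearEquiv.skewProd (LinearEquiv.refl ℝ E) (LinearEquiv.refl ℝ E)
    (-((Γ z.1).flip z.2 : E →ₗ[ℝ] E))
  let b := (e.prod f).map σ
  have hbl : ∀ i, b (Sum.inl i) = horizontalLift Γ z (e i) := fun i => by
    simp [b, σ, horizontalLift]
  have hbr : ∀ i, b (Sum.inr i) = (0, f i) := fun i => by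
    simp [b, σ]
  have hb : ∀ i j, bergerForm G Γ Φ δ z (b i) (b j) = if i = j then 1 else 0 := by
    have hlr : ∀ i j, bergerForm G Γ Φ δ z (b (Sum.inr i)) (b (Sum.inl j)) = 0 := fun i j => by
      rw [hbl, hbr, bergerForm_horizontalLift]; simp
    rintro (i | i) (j | j)
    · rw [hbl, hbl, bergerForm_horizontalLift]
      simp [horizontalLift, he]
    · rw [bergerForm_symm hs0, hlr]; simp
    · rw [hlr]; simp
    · rw [hbr, hbr, bergerForm_apply]
      simp only [connectionMap_apply, map_zero, zero_apply, add_zero, zero_add]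
      rw [mul_assoc, ← hVa, hf]
      simp
  let T : E × E →ₗ[ℝ] E × E →ₗ[ℝ] E := LinearMap.mk₂ ℝ
    (fun A B => S A.1 B.1 - (christoffelL (bergerForm G Γ Φ δ) z A B).1)
    (fun A A' B => by simp; abel) (fun c A B => by simp [smul_sub])
    (fun A B B' => by simp; abel) (fun c A B => by simp [smul_sub])
  let T' : E →ₗ[ℝ] E →ₗ[ℝ] E := LinearMap.mk₂ ℝ
    (fun A B => S A B - Γ z.1 A B)
    (fun A A' B => by simp; abel) (fun c A B => by simp [smul_sub])
    (fun A B B' => by simp; abel) (fun c A B => by simp [smul_sub])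
  have h1 := metricTrace_eq_sum (bergerForm G Γ Φ δ z) b hb T
  have h2 := metricTrace_eq_sum (G z.1) e he T'
  refine h1.trans (Eq.trans ?_ h2.symm)
  rw [Fintype.sum_sum_type]
  have h3 : ∀ i, T (b (Sum.inr i)) (b (Sum.inr i)) = 0 := fun i => by
    simp only [T, LinearMap.mk₂_apply, hbr]
    rw [fst_christoffelL_vertical hG hs hp hΓ hΦ hpar]
    simp
  have h4 : ∀ i, T (b (Sum.inl i)) (b (Sum.inl i)) = T' (e i) (e i) := fun i => by
    simp only [T, T', LinearMap.mk₂_apply, hbl]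
    rw [fst_christoffelL_horizontal hG hp hΓ hΦ]
    rfl
  simp only [h3, h4, Finset.sum_const_zero, add_zero]

end BergerForm

section Charts

variable {E : Type*} [NormedAddCommGroup E] [NormedSpace ℝ E]
  {H : Type*} [TopologicalSpace H] {I : ModelWithCorners ℝ E H}
  {M : Type*} [TopologicalSpace M] [ChartedSpace H M] [IsManifold I ∞ M]

theorem extChartAt_tangent_apply (u p : TangentBundle I M) :
    extChartAt I.tangent u p =
      (extChartAt I u.proj p.proj, tangentCoordChange I p.proj u.proj p.proj p.snd) := rfl

theorem mem_extChartAt_tangent_target (u : TangentBundle I M) (z : E × E) :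
    z ∈ (extChartAt I.tangent u).target ↔ z.1 ∈ (extChartAt I u.proj).target := by
  rw [FiberBundle.extChartAt_target]
  simp only [Set.mem_prod, Set.mem_inter_iff, Set.mem_preimage, Set.mem_univ, and_true,
    TangentBundle.trivializationAt_baseSet, and_iff_left_iff_imp]
  intro h
  have := (extChartAt I u.proj).map_target h
  rwa [extChartAt_source] at this

variable [I.Boundaryless]

omit [IsManifold I ∞ M] [I.Boundaryless] in
theorem mfderiv_eq_fderiv_extChartAt_comp {E' : Type*} [NormedAddCommGroup E'] [NormedSpace ℝ E']
    {f : E' → M} {y : E'} (hf : MDifferentiableAt 𝓘(ℝ, E') I f y) :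
    (mfderiv 𝓘(ℝ, E') I f y : E' →L[ℝ] E) = fderiv ℝ (fun z => extChartAt I (f y) (f z)) y := by
  refine hf.mfderiv.trans ?_
  rw [← fderivWithin_univ]
  simp only [writtenInExtChartAt, mfld_simps]
  rfl

theorem mfderiv_extChartAt_symm {x₀ : M} {y : E} (hy : y ∈ (extChartAt I x₀).target) :
    (mfderiv 𝓘(ℝ, E) I (extChartAt I x₀).symm y : E →L[ℝ] E) =
      tangentCoordChange I x₀ ((extChartAt I x₀).symm y) ((extChartAt I x₀).symm y) := by
  have h : MDifferentiableAt 𝓘(ℝ, E) I (extChartAt I x₀).symm y :=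
    ((contMDiffOn_extChartAt_symm (n := ∞) x₀).contMDiffAt
      ((isOpen_extChartAt_target x₀).mem_nhds hy)).mdifferentiableAt (by simp)
  rw [mfderiv_eq_fderiv_extChartAt_comp h, tangentCoordChange_def, I.range_eq_univ,
    fderivWithin_univ, (extChartAt I x₀).right_inv hy]
  rfl

omit [I.Boundaryless] in
theorem mfderiv_extChartAt {x₀ x : M} (hx : x ∈ (extChartAt I x₀).source) :
    (mfderiv I 𝓘(ℝ, E) (extChartAt I x₀) x : E →L[ℝ] E) = tangentCoordChange I x x₀ x := by
  refine (mdifferentiableAt_extChartAt (by rwa [extChartAt_source] at hx)).mfderiv.trans ?_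
  rw [tangentCoordChange_def]
  rfl

/-- The transition map between two charts. -/
def transition (I : ModelWithCorners ℝ E H) (x₀ x : M) : E → E :=
  fun y => extChartAt I x ((extChartAt I x₀).symm y)

omit [IsManifold I ∞ M] [I.Boundaryless] in
/-- The points of the coordinates at `x₀` also covered by the chart at `x`. -/
theorem transition_mem {x₀ x : M} {y : E} (h : (extChartAt I x₀).symm y ∈ (extChartAt I x).source) :
    transition I x₀ x y ∈ (extChartAt I x).target := (extChartAt I x).map_source h

omit [IsManifold I ∞ M] in
theorem eventually_mem_overlap {x₀ x : M} {y : E} (hy : y ∈ (extChartAt I x₀).target)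
    (h : (extChartAt I x₀).symm y ∈ (extChartAt I x).source) :
    ∀ᶠ z in nhds y, z ∈ (extChartAt I x₀).target ∧
      (extChartAt I x₀).symm z ∈ (extChartAt I x).source :=
  Filter.Eventually.and ((isOpen_extChartAt_target x₀).mem_nhds hy) <|
    (continuousAt_extChartAt_symm'' hy).eventually ((isOpen_extChartAt_source x).mem_nhds h)

theorem contDiffAt_transition {x₀ x : M} {y : E} (hy : y ∈ (extChartAt I x₀).target)
    (h : (extChartAt I x₀).symm y ∈ (extChartAt I x).source) :
    ContDiffAt ℝ ∞ (transition I x₀ x) y := by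
  rw [← contDiffWithinAt_univ, ← I.range_eq_univ]
  exact contDiffWithinAt_ext_coord_change x x₀ ⟨hy, h⟩

theorem fderiv_transition {x₀ x : M} {y : E} (hy : y ∈ (extChartAt I x₀).target) :
    fderiv ℝ (transition I x₀ x) y = tangentCoordChange I x₀ x ((extChartAt I x₀).symm y) := by
  rw [tangentCoordChange_def, I.range_eq_univ,
    fderivWithin_univ, (extChartAt I x₀).right_inv hy]
  rfl

omit [I.Boundaryless] in
theorem tangentCoordChange_tangentCoordChange {x₀ x z : M} (h₀ : z ∈ (extChartAt I x₀).source)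
    (h : z ∈ (extChartAt I x).source) (v : E) :
    tangentCoordChange I x x₀ z (tangentCoordChange I x₀ x z v) = v := by
  rw [tangentCoordChange_comp ⟨⟨h₀, h⟩, h₀⟩, tangentCoordChange_self h₀]

/-- The differential of the inverse of a chart of the tangent bundle. -/
theorem mfderiv_extChartAt_tangent_symm (u : TangentBundle I M) {z : E × E}
    (hz : z.1 ∈ (extChartAt I u.proj).target) (A : E × E) :
    letI τ := transition I u.proj ((extChartAt I u.proj).symm z.1)
    (mfderiv 𝓘(ℝ, E × E) I.tangent (extChartAt I.tangent u).symm z : E × E →L[ℝ] E × E) A =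
      (fderiv ℝ τ z.1 A.1, fderiv ℝ (fderiv ℝ τ) z.1 A.1 z.2 + fderiv ℝ τ z.1 A.2) := by
  set x := (extChartAt I u.proj).symm z.1 with hx
  set τ := transition I u.proj x with hτ
  have hxs : x ∈ (extChartAt I x).source := mem_extChartAt_source x
  have h : MDifferentiableAt 𝓘(ℝ, E × E) I.tangent (extChartAt I.tangent u).symm z :=
    ((contMDiffOn_extChartAt_symm (n := ∞) u).contMDiffAt
      ((isOpen_extChartAt_target u).mem_nhds
        ((mem_extChartAt_tangent_target u z).2 hz))).mdifferentiableAt (by simp)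
  rw [mfderiv_eq_fderiv_extChartAt_comp h]
  have hev : (fun z' => extChartAt I.tangent ((extChartAt I.tangent u).symm z)
      ((extChartAt I.tangent u).symm z')) =ᶠ[nhds z]
        fun z' => (τ z'.1, fderiv ℝ τ z'.1 z'.2) := by
    filter_upwards [continuousAt_fst.eventually (eventually_mem_overlap hz hxs)] with z' hz'
    rw [extChartAt_tangent_apply, fderiv_transition hz'.1]
    refine Prod.ext rfl ?_
    exact tangentCoordChange_comp
      ⟨⟨(extChartAt I u.proj).map_target hz'.1, mem_extChartAt_source _⟩, hz'.2⟩
  rw [hev.fderiv_eq]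
  have hτd := contDiffAt_transition hz hxs
  have hτ1 : HasFDerivAt τ (fderiv ℝ τ z.1) z.1 := (hτd.differentiableAt (by simp)).hasFDerivAt
  have hτ2 : HasFDerivAt (fderiv ℝ τ) (fderiv ℝ (fderiv ℝ τ) z.1) z.1 :=
    ((hτd.fderiv_right (m := 1) (by norm_cast)).differentiableAt (by simp)).hasFDerivAt
  have h1 := (hτ1.comp z (hasFDerivAt_fst (𝕜 := ℝ) (p := z))).prodMk
    ((hτ2.comp z (hasFDerivAt_fst (𝕜 := ℝ) (p := z))).clm_apply
      (hasFDerivAt_snd (𝕜 := ℝ) (p := z)))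
  have h2 : HasFDerivAt (fun z' : E × E => (τ z'.1, fderiv ℝ τ z'.1 z'.2)) _ z := h1
  rw [h2.fderiv]
  exact Prod.ext rfl (add_comm _ _)

end Charts

section CoordMetric

variable {E : Type*} [NormedAddCommGroup E] [NormedSpace ℝ E]
  {H : Type*} [TopologicalSpace H] {I : ModelWithCorners ℝ E H}
  {M : Type*} [TopologicalSpace M] [ChartedSpace H M] [IsManifold I ∞ M]

/-- The scalar product on `T_x M`, as a bilinear form on the model space. -/
def innerForm (g : ContMDiffRiemannianMetric I ∞ E (fun x : M => TangentSpace I x)) (x : M) :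
    E →L[ℝ] E →L[ℝ] ℝ := g.inner x

/-- The coordinate expression of a metric, as a field of continuous bilinear forms. -/
def coordMetricL (g : ContMDiffRiemannianMetric I ∞ E (fun x : M => TangentSpace I x)) (x₀ : M)
    (y : E) : E →L[ℝ] E →L[ℝ] ℝ :=
  letI x := (extChartAt I x₀).symm y
  (innerForm g x).bilinearComp (tangentCoordChange I x₀ x x) (tangentCoordChange I x₀ x x)

variable (g : ContMDiffRiemannianMetric I ∞ E (fun x : M => TangentSpace I x)) {x₀ : M} {y : E}

theorem coordMetricL_apply (u v : E) : coordMetricL g x₀ y u v =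
    innerForm g ((extChartAt I x₀).symm y)
      (tangentCoordChange I x₀ ((extChartAt I x₀).symm y) ((extChartAt I x₀).symm y) u)
      (tangentCoordChange I x₀ ((extChartAt I x₀).symm y) ((extChartAt I x₀).symm y) v) := rfl

theorem innerForm_symm (x : M) (u v : E) :
    innerForm g x u v = innerForm g x v u := g.symm x u v

theorem coordMetricL_symm (u v : E) : coordMetricL g x₀ y u v = coordMetricL g x₀ y v u := by
  rw [coordMetricL_apply, coordMetricL_apply, innerForm_symm]

theorem coordMetricL_pos (hy : y ∈ (extChartAt I x₀).target) (v : E) (hv : v ≠ 0) :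
    0 < coordMetricL g x₀ y v v := by
  refine g.pos _ _ fun h => hv ?_
  have hx := (extChartAt I x₀).map_target hy
  have h1 := tangentCoordChange_tangentCoordChange (v := v) hx
    (mem_extChartAt_source ((extChartAt I x₀).symm y))
  rw [← h1]
  exact (congrArg _ h).trans (map_zero _)

theorem coordMetricL_of_symm_eq {x : M} (hx : (extChartAt I x₀).symm y = x) (u v : E) :
    coordMetricL g x₀ y u v =
      innerForm g x (tangentCoordChange I x₀ x x u) (tangentCoordChange I x₀ x x v) := by
  subst hx; rfl

theorem coordMetricL_transition {x : M} (hy : y ∈ (extChartAt I x₀).target)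
    (h : (extChartAt I x₀).symm y ∈ (extChartAt I x).source) (u v : E) :
    coordMetricL g x₀ y u v = coordMetricL g x (transition I x₀ x y)
      (tangentCoordChange I x₀ x ((extChartAt I x₀).symm y) u)
      (tangentCoordChange I x₀ x ((extChartAt I x₀).symm y) v) := by
  have hx := (extChartAt I x₀).map_target hy
  rw [coordMetricL_of_symm_eq g (y := transition I x₀ x y) ((extChartAt I x).left_inv h),
    tangentCoordChange_comp ⟨⟨hx, h⟩, mem_extChartAt_source _⟩,
    tangentCoordChange_comp ⟨⟨hx, h⟩, mem_extChartAt_source _⟩]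
  rfl

variable [I.Boundaryless]

theorem coordMetric_eq (hy : y ∈ (extChartAt I x₀).target) (u v : E) :
    coordMetric I (metricField g) x₀ y u v = coordMetricL g x₀ y u v := by
  have h := mfderiv_extChartAt_symm hy
  exact congrArg₂ (fun a b : E => innerForm g ((extChartAt I x₀).symm y) a b)
    (DFunLike.congr_fun h u) (DFunLike.congr_fun h v)

omit [I.Boundaryless] in
/-- Coordinate vector fields are smooth sections. -/
theorem contMDiffOn_coordVectorField (x₀ : M) (u : E) :
    ContMDiffOn 𝓘(ℝ, E) I.tangent ∞ (fun y => (⟨(extChartAt I x₀).symm y,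
      tangentCoordChange I x₀ ((extChartAt I x₀).symm y) ((extChartAt I x₀).symm y) u⟩ :
        TangentBundle I M)) (extChartAt I x₀).target := by
  have h1 := contMDiffOn_extChartAt_symm (I := I.tangent) (n := ∞) (⟨x₀, 0⟩ : TangentBundle I M)
  have h2 : ContMDiffOn 𝓘(ℝ, E) 𝓘(ℝ, E × E) ∞ (fun y : E => (y, u)) (extChartAt I x₀).target :=
    (contDiff_id.prodMk contDiff_const).contMDiff.contMDiffOn
  exact h1.comp h2 fun y hy => (mem_extChartAt_tangent_target _ _).2 hy

variable [FiniteDimensional ℝ E]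

omit [I.Boundaryless] in
theorem contDiffOn_coordMetricL (x₀ : M) :
    ContDiffOn ℝ ∞ (coordMetricL g x₀) (extChartAt I x₀).target := by
  refine contDiffOn_clm_apply.2 fun u => contDiffOn_clm_apply.2 fun v => ?_
  rw [← contMDiffOn_iff_contDiffOn]
  intro y hy
  have hu := contMDiffOn_coordVectorField (I := I) x₀ u y hy
  have hv := contMDiffOn_coordVectorField (I := I) x₀ v y hy
  have hb := contMDiffOn_extChartAt_symm (I := I) (n := ∞) x₀ y hy
  have : ContMDiffWithinAt 𝓘(ℝ, E) (I.prod 𝓘(ℝ)) ∞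
      (fun y => TotalSpace.mk' ℝ (E := Bundle.Trivial M ℝ) ((extChartAt I x₀).symm y)
        (coordMetricL g x₀ y u v)) (extChartAt I x₀).target y := by
    refine ContMDiffWithinAt.clm_bundle_apply₂ (F₁ := E) (F₂ := E) (F₃ := ℝ)
      (E₁ := fun x : M => TangentSpace I x) (E₂ := fun x : M => TangentSpace I x)
      (E₃ := Bundle.Trivial M ℝ) (b := (extChartAt I x₀).symm)
      (ψ := fun y => g.inner ((extChartAt I x₀).symm y))
      (v := fun y => tangentCoordChange I x₀ ((extChartAt I x₀).symm y)
        ((extChartAt I x₀).symm y) u)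
      (w := fun y => tangentCoordChange I x₀ ((extChartAt I x₀).symm y)
        ((extChartAt I x₀).symm y) v) ?_ hu hv
    exact ContMDiffAt.comp_contMDiffWithinAt y g.contMDiff.contMDiffAt hb
  simp only [contMDiffWithinAt_totalSpace] at this
  exact this.2

theorem differentiableAt_coordMetricL (hy : y ∈ (extChartAt I x₀).target) :
    DifferentiableAt ℝ (coordMetricL g x₀) y :=
  ((contDiffOn_coordMetricL g x₀).contDiffAt
    ((isOpen_extChartAt_target x₀).mem_nhds hy)).differentiableAt (by simp)

theorem differentiableAt_christoffelL (hy : y ∈ (extChartAt I x₀).target) :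
    DifferentiableAt ℝ (christoffelL (coordMetricL g x₀)) y :=
  ((contDiffOn_christoffelL (isOpen_extChartAt_target x₀) (contDiffOn_coordMetricL g x₀)
    fun _ hz => coordMetricL_pos g hz).contDiffAt
    ((isOpen_extChartAt_target x₀).mem_nhds hy)).differentiableAt (by simp)

theorem christoffelAt_eq (u v : E) (x : M) : christoffelAt I (metricField g) x u v =
    christoffelL (coordMetricL g x) (extChartAt I x x) u v := by
  have hy := mem_extChartAt_target (I := I) x
  unfold christoffelAt
  rw [christoffel_congr (G' := fun z u v => coordMetricL g x z u v)]
  · exact christoffel_eq_christoffelL (differentiableAt_coordMetricL g hy) (coordMetricL_symm g)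
      (coordMetricL_pos g hy) u v
  · filter_upwards [(isOpen_extChartAt_target (I := I) x).mem_nhds hy] with z hz
    funext u v
    exact coordMetric_eq g hz u v

/-- The change of the Christoffel symbols under the transition maps. -/
theorem christoffelL_transition {x : M} (hy : y ∈ (extChartAt I x₀).target)
    (h : (extChartAt I x₀).symm y ∈ (extChartAt I x).source) (u v : E) :
    letI τ := transition I x₀ x
    fderiv ℝ τ y (christoffelL (coordMetricL g x₀) y u v) = fderiv ℝ (fderiv ℝ τ) y u v +
      christoffelL (coordMetricL g x) (τ y) (fderiv ℝ τ y u) (fderiv ℝ τ y v) := by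
  have hτ := transition_mem h
  have hx := (extChartAt I x₀).map_target hy
  refine christoffelL_transform (differentiableAt_coordMetricL g hy)
    (differentiableAt_coordMetricL g hτ) (contDiffAt_transition hy h) (coordMetricL_pos g hy)
    (coordMetricL_pos g hτ) (coordMetricL_symm g) (fun w => ?_) ?_ u v
  · rw [fderiv_transition hy]
    exact ⟨_, tangentCoordChange_tangentCoordChange h hx w⟩
  · filter_upwards [eventually_mem_overlap hy h] with z hz u v
    rw [fderiv_transition hz.1]
    exact coordMetricL_transition g hz.1 hz.2 u v

end CoordMetric

section CoordEndo

variable {E : Type*} [NormedAddCommGroup E] [NormedSpace ℝ E]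
  {H : Type*} [TopologicalSpace H] {I : ModelWithCorners ℝ E H}
  {M : Type*} [TopologicalSpace M] [ChartedSpace H M] [IsManifold I ∞ M]
  (φ : ∀ x : M, TangentSpace I x →L[ℝ] TangentSpace I x) {x₀ : M} {y : E}

/-- An endomorphism of `T_x M`, as an endomorphism of the model space. -/
def endoForm (φ : ∀ x : M, TangentSpace I x →L[ℝ] TangentSpace I x) (x : M) : E →L[ℝ] E := φ x

/-- The coordinate expression of an endomorphism field. -/
def coordEndoL (φ : ∀ x : M, TangentSpace I x →L[ℝ] TangentSpace I x) (x₀ : M) (y : E) :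
    E →L[ℝ] E :=
  letI x := (extChartAt I x₀).symm y
  tangentCoordChange I x x₀ x ∘L endoForm φ x ∘L tangentCoordChange I x₀ x x

variable [I.Boundaryless]

theorem coordEndo_eq (hy : y ∈ (extChartAt I x₀).target) (v : E) :
    coordEndo I φ x₀ y v = coordEndoL φ x₀ y v := by
  have h := DFunLike.congr_fun (mfderiv_extChartAt_symm hy) v
  have h' := mfderiv_extChartAt ((extChartAt I x₀).map_target hy)
  refine (DFunLike.congr_fun h' _).trans ?_
  exact congrArg (fun w : E => tangentCoordChange I _ x₀ _ (endoForm φ _ w)) h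

variable [FiniteDimensional ℝ E]

theorem differentiableAt_coordEndoL
    (hφ : ContMDiff I (I.prod 𝓘(ℝ, E →L[ℝ] E)) ∞
      (fun x : M => TotalSpace.mk' (E →L[ℝ] E)
        (E := fun x : M => TangentSpace I x →L[ℝ] TangentSpace I x) x (φ x)))
    (hy : y ∈ (extChartAt I x₀).target) : DifferentiableAt ℝ (coordEndoL φ x₀) y := by
  have h : ContDiffOn ℝ ∞ (coordEndoL φ x₀) (extChartAt I x₀).target := by
    refine contDiffOn_clm_apply.2 fun v => ?_
    rw [← contMDiffOn_iff_contDiffOn]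
    have h1 : ContMDiffOn 𝓘(ℝ, E) I.tangent ∞ (fun y => (⟨(extChartAt I x₀).symm y,
        endoForm φ ((extChartAt I x₀).symm y) (tangentCoordChange I x₀ ((extChartAt I x₀).symm y)
          ((extChartAt I x₀).symm y) v)⟩ : TangentBundle I M)) (extChartAt I x₀).target := by
      intro y hy
      apply ContMDiffWithinAt.clm_bundle_apply (F₁ := E)
        (E₁ := fun x : M => TangentSpace I x) (E₂ := fun x : M => TangentSpace I x)
      · exact ContMDiffAt.comp_contMDiffWithinAt y hφ.contMDiffAt
          (contMDiffOn_extChartAt_symm (I := I) (n := ∞) x₀ y hy)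
      · exact contMDiffOn_coordVectorField x₀ v y hy
    have h2 := contMDiffOn_extChartAt (I := I.tangent) (n := ∞)
      (x := (⟨x₀, 0⟩ : TangentBundle I M))
    have h3 := h2.comp h1 fun y hy => by
      rw [Set.mem_preimage, TangentBundle.mem_chart_source_iff, ← extChartAt_source I]
      exact (extChartAt I x₀).map_target hy
    exact contDiff_snd.contMDiff.comp_contMDiffOn h3
  exact (h.contDiffAt ((isOpen_extChartAt_target x₀).mem_nhds hy)).differentiableAt (by simp)

end CoordEndo

section Projection

variable {E : Type*} [NormedAddCommGroup E] [NormedSpace ℝ E] [FiniteDimensional ℝ E]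
  {H : Type*} [TopologicalSpace H] {I : ModelWithCorners ℝ E H}
  {M : Type*} [TopologicalSpace M] [ChartedSpace H M] [IsManifold I ∞ M]
  (g : ContMDiffRiemannianMetric I ∞ E (fun x : M => TangentSpace I x))
  (φ : ∀ x : M, TangentSpace I x →L[ℝ] TangentSpace I x) (δ : ℝ)

variable [I.Boundaryless]

/-- The coordinate expression of the Berger type deformed Sasaki metric. -/
theorem coordMetric_bergerSasaki (u : TangentBundle I M) {z : E × E}
    (hz : z.1 ∈ (extChartAt I u.proj).target) (A B : E × E) :
    coordMetric I.tangent (bergerSasaki g φ δ) u z A B =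
      bergerForm (coordMetricL g u.proj) (christoffelL (coordMetricL g u.proj))
        (coordEndoL φ u.proj) δ z A B := by
  set x₀ := u.proj with hx₀
  set x := (extChartAt I x₀).symm z.1 with hx
  set p : TangentBundle I M := (extChartAt I.tangent u).symm z with hp
  have hxx : (extChartAt I x₀).symm z.1 ∈ (extChartAt I x).source := mem_extChartAt_source x
  have hx0 : x ∈ (extChartAt I x₀).source := (extChartAt I x₀).map_target hz
  set D := tangentCoordChange I x₀ x x with hD
  have hDτ : fderiv ℝ (transition I x₀ x) z.1 = D := fderiv_transition hz
  have hW : ∀ A : E × E,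
      (mfderiv 𝓘(ℝ, E × E) I.tangent (extChartAt I.tangent u).symm z : E × E →L[ℝ] E × E) A =
      (D A.1, fderiv ℝ (fderiv ℝ (transition I x₀ x)) z.1 A.1 z.2 + D A.2) := fun A => by
    rw [mfderiv_extChartAt_tangent_symm u hz A, ← hDτ]
  have hK : ∀ A : E × E, fderiv ℝ (fderiv ℝ (transition I x₀ x)) z.1 A.1 z.2 + D A.2
      + christoffelAt I (metricField g) x (D A.1) (D z.2) =
        D (connectionMap (christoffelL (coordMetricL g x₀)) z A) := fun A => by
    have h := christoffelL_transition g hz hxx A.1 z.2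
    rw [connectionMap_apply, map_add, christoffelAt_eq, ← hDτ, h]
    change _ + _ + christoffelL (coordMetricL g x) (transition I x₀ x z.1) _ _ = _
    abel
  have hφ : endoForm φ x (D z.2) = D (coordEndoL φ x₀ z.1 z.2) :=
    (tangentCoordChange_tangentCoordChange (I := I) hxx hx0 _).symm
  have h0 : coordMetric I.tangent (bergerSasaki g φ δ) u z A B =
      bergerSasaki g φ δ p
        ((mfderiv 𝓘(ℝ, E × E) I.tangent (extChartAt I.tangent u).symm z : E × E →L[ℝ] E × E) A)
        ((mfderiv 𝓘(ℝ, E × E) I.tangent (extChartAt I.tangent u).symm z : E × E →L[ℝ] E × E) B) :=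
    rfl
  have h1 : bergerSasaki g φ δ p
      (D A.1, fderiv ℝ (fderiv ℝ (transition I x₀ x)) z.1 A.1 z.2 + D A.2)
      (D B.1, fderiv ℝ (fderiv ℝ (transition I x₀ x)) z.1 B.1 z.2 + D B.2) =
      innerForm g x (D A.1) (D B.1)
      + (innerForm g x (fderiv ℝ (fderiv ℝ (transition I x₀ x)) z.1 A.1 z.2 + D A.2
          + christoffelAt I (metricField g) x (D A.1) (D z.2))
          (fderiv ℝ (fderiv ℝ (transition I x₀ x)) z.1 B.1 z.2 + D B.2
          + christoffelAt I (metricField g) x (D B.1) (D z.2))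
        + δ ^ 2 * innerForm g x (fderiv ℝ (fderiv ℝ (transition I x₀ x)) z.1 A.1 z.2 + D A.2
          + christoffelAt I (metricField g) x (D A.1) (D z.2)) (endoForm φ x (D z.2))
          * innerForm g x (fderiv ℝ (fderiv ℝ (transition I x₀ x)) z.1 B.1 z.2 + D B.2
          + christoffelAt I (metricField g) x (D B.1) (D z.2)) (endoForm φ x (D z.2))) := rfl
  rw [h0, hW, hW, h1, hK, hK, hφ, bergerForm_apply]
  rfl

omit [FiniteDimensional ℝ E] in
theorem writtenInExtChartAt_proj_eventuallyEq (u : TangentBundle I M) :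
    writtenInExtChartAt I.tangent I u (fun v : TangentBundle I M => v.proj)
      =ᶠ[nhds (extChartAt I.tangent u u)] Prod.fst := by
  filter_upwards [extChartAt_target_mem_nhds (I := I.tangent) u] with z hz
  exact (extChartAt I u.proj).right_inv ((mem_extChartAt_tangent_target u z).1 hz)

/-- The tension field of the projection. -/
theorem tensionField_proj (h : ContMDiffRiemannianMetric I ∞ E (fun x : M => TangentSpace I x))
    (hg : IsAntiParaKahler g φ) (u : TangentBundle I M) :
    tensionField I.tangent I (bergerSasaki g φ δ) (metricField h)
        (fun v : TangentBundle I M => v.proj) u =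
      metricTrace (coordMetric I (metricField g) u.proj (extChartAt I u.proj u.proj))
        (fun a b => christoffelAt I (metricField h) u.proj a b
          - christoffelAt I (metricField g) u.proj a b) := by
  set x₀ := u.proj
  have hy := mem_extChartAt_target (I := I) x₀
  set z := extChartAt I.tangent u u with hz
  have hz1 : z.1 = extChartAt I x₀ x₀ := rfl
  have hzt : z.1 ∈ (extChartAt I x₀).target := hy
  have hG := differentiableAt_coordMetricL g hzt
  have hΓ := differentiableAt_christoffelL g hzt
  have hΦ := differentiableAt_coordEndoL φ hg.antiParaHermitian.almostParacomplex.smooth hzt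
  have hpos := coordMetricL_pos g hzt
  have hchr : ∀ A B : E × E, christoffelAt I.tangent (bergerSasaki g φ δ) u A B =
      christoffelL (bergerForm (coordMetricL g x₀) (christoffelL (coordMetricL g x₀))
        (coordEndoL φ x₀) δ) z A B := fun A B => by
    unfold christoffelAt
    rw [christoffel_congr (G' := fun z A B => bergerForm (coordMetricL g x₀)
      (christoffelL (coordMetricL g x₀)) (coordEndoL φ x₀) δ z A B)]
    · exact christoffel_eq_christoffelL (differentiableAt_bergerForm hG hΓ hΦ)
        (bergerForm_symm (coordMetricL_symm g)) (bergerForm_pos hpos) A B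
    · filter_upwards [extChartAt_target_mem_nhds (I := I.tangent) u] with z' hz'
      funext A B
      exact coordMetric_bergerSasaki g φ δ u ((mem_extChartAt_tangent_target u z').1 hz') A B
  have hpar : ∀ c v, fderiv ℝ (coordEndoL φ x₀) z.1 c v
      + christoffelL (coordMetricL g x₀) z.1 c (coordEndoL φ x₀ z.1 v)
      - coordEndoL φ x₀ z.1 (christoffelL (coordMetricL g x₀) z.1 c v) = 0 := fun c v => by
    have h0 := hg.parallel x₀ c v
    unfold covDerivEndo at h0
    have h1 : (fun y => coordEndo I φ x₀ y v) =ᶠ[nhds z.1] fun y => coordEndoL φ x₀ y v := by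
      filter_upwards [(isOpen_extChartAt_target x₀).mem_nhds hzt] with y hy
      exact coordEndo_eq φ hy v
    have h2 : fderiv ℝ (fun y => coordEndoL φ x₀ y v) z.1 c =
        fderiv ℝ (coordEndoL φ x₀) z.1 c v := by
      rw [(hΦ.hasFDerivAt.clm_apply (hasFDerivAt_const v _)).fderiv]
      simp
    rw [← h2, ← h1.fderiv_eq, ← h0]
    simp only [christoffelAt_eq, coordEndo_eq φ hy]
    rfl
  have hF := writtenInExtChartAt_proj_eventuallyEq u
  have hF1 : fderiv ℝ (writtenInExtChartAt I.tangent I u (fun v : TangentBundle I M => v.proj)) z =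
      ContinuousLinearMap.fst ℝ E E := by rw [hF.fderiv_eq, fderiv_fst]
  have hF2 : fderiv ℝ (fderiv ℝ (writtenInExtChartAt I.tangent I u
      (fun v : TangentBundle I M => v.proj))) z = 0 := by
    rw [Filter.EventuallyEq.fderiv_eq
      (f := fun _ => ContinuousLinearMap.fst ℝ E E) (hF.fderiv.trans ?_)]
    · simp
    · exact Filter.Eventually.of_forall fun z => fderiv_fst
  have hS : secondFundamentalForm I.tangent I (bergerSasaki g φ δ) (metricField h)
      (fun v : TangentBundle I M => v.proj) u = fun A B : E × E =>
        christoffelL (coordMetricL h x₀) z.1 A.1 B.1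
        - (christoffelL (bergerForm (coordMetricL g x₀) (christoffelL (coordMetricL g x₀))
          (coordEndoL φ x₀) δ) z A B).1 := by
    funext A B
    unfold secondFundamentalForm
    rw [hF1, hF2, hchr, christoffelAt_eq]
    simp only [zero_apply, zero_sub, ContinuousLinearMap.coe_fst']
    exact neg_add_eq_sub _ _
  unfold tensionField
  rw [hS]
  have hB : coordMetric I.tangent (bergerSasaki g φ δ) u z = fun A B =>
      bergerForm (coordMetricL g x₀) (christoffelL (coordMetricL g x₀))
        (coordEndoL φ x₀) δ z A B := by
    funext A B; exact coordMetric_bergerSasaki g φ δ u hzt A B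
  have hB' : coordMetric I (metricField g) x₀ (extChartAt I x₀ x₀) = fun a b =>
      coordMetricL g x₀ z.1 a b := by
    funext a b; exact coordMetric_eq g hzt a b
  refine Eq.trans ?_ ((metricTrace_bergerForm (δ := δ) hG
    (Filter.Eventually.of_forall fun _ => coordMetricL_symm g) hpos hΓ hΦ hpar
    (christoffelL (coordMetricL h x₀) z.1)).trans ?_)
  · exact congrArg (fun B => metricTrace B _) hB
  · rw [hB']
    simp only [christoffelAt_eq]
    rfl

end Projection

end

theorem mainTheorem7 (k : ℕ) {M : Type*} [TopologicalSpace M]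
    [ChartedSpace (EuclideanSpace ℝ (Fin (2 * k))) M] [IsManifold (𝓡 (2 * k)) ∞ M]
    (g h : ContMDiffRiemannianMetric (𝓡 (2 * k)) ∞ (EuclideanSpace ℝ (Fin (2 * k)))
      (fun x : M => TangentSpace (𝓡 (2 * k)) x))
    (φ φ₁ : ∀ x : M, TangentSpace (𝓡 (2 * k)) x →L[ℝ] TangentSpace (𝓡 (2 * k)) x)
    (δ : ℝ) (hg : IsAntiParaKahler g φ) (hh : IsAntiParaHermitian h φ₁) :
    IsHarmonicMap (𝓡 (2 * k)).tangent (𝓡 (2 * k)) (bergerSasaki g φ δ) (metricField h)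
        (fun v : TangentBundle (𝓡 (2 * k)) M => v.proj) ↔
      IsHarmonicMetric (𝓡 (2 * k)) (metricField g) (metricField h) := by
  constructor
  · intro H x
    exact (tensionField_proj g φ δ h hg ⟨x, 0⟩).symm.trans (H.2 ⟨x, 0⟩)
  · intro H
    exact ⟨contMDiff_proj _, fun u => (tensionField_proj g φ δ h hg u).trans (H u.proj)⟩
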